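/- Let $n\ge 0$ be an integer and let $\lambda_0,\lambda_1,\lambda_2\in\mathbb{C}$ be such that all the zeros of $U(z)=\lambda_0+n\lambda_1 z+\frac{n(n-1)}{2}\lambda_2z^2$ lie in the half plane $|z|\le|z-n/2|$. For a complex polynomial $P$ of degree at most $n$ put $$B[P](z)=\lambda_0P(z)+\lambda_1\Big(\frac{nz}{2}\Big)\frac{P'(z)}{1!}+\lambda_2\Big(\frac{nz}{2}\Big)^2\frac{P''(z)}{2!}.$$ Let $0<k\le 1$, $R>r\ge k$, $\alpha\in\mathbb{C}$ with $|\alpha|\le1$, and put $\sigma(z)=Rz$, $\rho(z)=rz$. If $P$ is a complex polynomial of degree at most $n$ with $P(z)\neq0$ for $|z|<k$, then for $|z|=1$ $$\big|B[P\circ\sigma](z)-\alpha B[P\circ\rho](z)\big|\le\frac12\Big[\Big\{\frac{|B[z^n]|}{k^n}|R^n-\alpha r^n|+|1-\alpha||\lambda_0|\Big\}\max_{|z|=k}|P(z)|-\Big\{\frac{|B[z^n]|}{k^n}|R^n-\alpha r^n|-|1-\alpha||\lambda_0|\Big\}\min_{|z|=k}|P(z)|\Big],$$ where $B[z^n]$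 is evaluated at the same point $z$. The result is sharp, with extremal polynomials $az^n+b$, $|a|=|b|\ne0$: if $n\ge1$ and $|a|=|b|\neq0$, then $P(z)=az^n+b$ has degree exactly $n$, does not vanish in $|z|<k$, and equality holds at some point $z$ with $|z|=1$. -/

import Mathlib

open Polynomial

noncomputable section

/-- The polynomial `U(z) = l₀ + n l₁ z + (n(n-1)/2) l₂ z²` attached to the parameters. -/
def rahmanU (n : ℕ) (l₀ l₁ l₂ : ℂ) : ℂ[X] :=
  C l₀ + C ((n : ℂ) * l₁) * X + C ((n : ℂ) * ((n : ℂ) - 1) / 2 * l₂) * X ^ 2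

/-- The parameters define an operator of the class `𝓑ₙ`: all the zeros of `U` lie in the
half plane `|z| ≤ |z - n/2|`. -/
def RahmanAdmissible (n : ℕ) (l₀ l₁ l₂ : ℂ) : Prop :=
  ∀ z : ℂ, (rahmanU n l₀ l₁ l₂).eval z = 0 → ‖z‖ ≤ ‖z - (n : ℂ) / 2‖

/-- The operator `B[P](z) = l₀ P(z) + l₁ (nz/2) P'(z)/1! + l₂ (nz/2)² P''(z)/2!`. -/
def rahmanB (n : ℕ) (l₀ l₁ l₂ : ℂ) (P : ℂ[X]) : ℂ[X] :=
  C l₀ * P + C l₁ * (C ((n : ℂ) / 2) * X) * derivative P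
    + C l₂ * (C ((n : ℂ) / 2) * X) ^ 2 * (C (1 / 2) * derivative (derivative P))

/-- The polynomial `z ↦ P(s z)`. -/
def dilate (P : ℂ[X]) (s : ℝ) : ℂ[X] := P.comp (C (s : ℂ) * X)

/-- The maximum of `|P(z)|` on the circle `|z| = k`. -/
def maxModulus (P : ℂ[X]) (k : ℝ) : ℝ := sSup ((fun z : ℂ => ‖P.eval z‖) '' Metric.sphere 0 k)

/-- The minimum of `|P(z)|` on the circle `|z| = k`. -/
def minModulus (P : ℂ[X]) (k : ℝ) : ℝ := sInf ((fun z : ℂ => ‖P.eval z‖) '' Metric.sphere 0 k)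

theorem maxModulus_isGreatest (P : ℂ[X]) {k : ℝ} (hk : 0 ≤ k) :
    IsGreatest ((fun z : ℂ => ‖P.eval z‖) '' Metric.sphere 0 k) (maxModulus P k) :=
  ((isCompact_sphere (0 : ℂ) k).image (by fun_prop)).isGreatest_sSup
    ((NormedSpace.sphere_nonempty.2 hk).image _)

theorem minModulus_isLeast (P : ℂ[X]) {k : ℝ} (hk : 0 ≤ k) :
    IsLeast ((fun z : ℂ => ‖P.eval z‖) '' Metric.sphere 0 k) (minModulus P k) :=
  ((isCompact_sphere (0 : ℂ) k).image (by fun_prop)).isLeast_sInf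
    ((NormedSpace.sphere_nonempty.2 hk).image _)

/-- The left-hand side `|B[P∘σ](z) - α B[P∘ρ](z)|`, where `σ(z) = Rz` and `ρ(z) = rz`. -/
def lhsAt (n : ℕ) (l₀ l₁ l₂ α : ℂ) (R r : ℝ) (P : ℂ[X]) (z : ℂ) : ℝ :=
  ‖(rahmanB n l₀ l₁ l₂ (dilate P R)).eval z - α * (rahmanB n l₀ l₁ l₂ (dilate P r)).eval z‖

/-- The right-hand side
`½ [ {(|B[zⁿ]|/kⁿ) |Rⁿ - α rⁿ| + |1 - α| |l₀|} max_{|z|=k} |P|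
   - {(|B[zⁿ]|/kⁿ) |Rⁿ - α rⁿ| - |1 - α| |l₀|} min_{|z|=k} |P| ]`. -/
def rhsAt (n : ℕ) (l₀ l₁ l₂ α : ℂ) (R r k : ℝ) (P : ℂ[X]) (z : ℂ) : ℝ :=
  (1 / 2) *
    ((‖(rahmanB n l₀ l₁ l₂ (X ^ n)).eval z‖ / k ^ n * ‖(R : ℂ) ^ n - α * (r : ℂ) ^ n‖
        + ‖1 - α‖ * ‖l₀‖) * maxModulus P k
      - (‖(rahmanB n l₀ l₁ l₂ (X ^ n)).eval z‖ / k ^ n * ‖(R : ℂ) ^ n - α * (r : ℂ) ^ n‖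
        - ‖1 - α‖ * ‖l₀‖) * minModulus P k)

end

/-! Scaling by `k` reduces everything to `k = 1`. For fixed `z` on the unit circle, let `L` be the
linear functional `P ↦ B[P](Rz) - α B[P](rz)`, and write `P*` for the conjugate reciprocal.

The root of the argument is that `B` keeps zeros in a disc (`rahmanB_eval_ne_zero`). If `P` has
degree `n` and all its zeros satisfy `|z| < |w|`, then `B[P](w) / P(w)` is a polarised quadratic
evaluated at two points of the half plane `Re > 1/2`. Its diagonal is `U(nv/2)`, whose zeros satisfy
`Re v ≤ 1/2`, so coincidence forbids the value 0. Hence `L(P*) ≠ 0` when `P` has no zero in the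
closed disc. Consequently `|f| ≤ |g|` on the circle, with `g` zero-free in the closed disc, gives
`|L(f*)| ≤ |L(g*)|`.

Comparing `p - c` with its reciprocal, for constants `c` of modulus just above `M = max |p|` or just
below `m = min |p|`, gives an upper bound for `|L(p)| + |L(p*)|` and a lower bound for `|L(p*)| -
|L(p)|`. Half of their difference is the theorem. -/

/-! ### Coincidence for quadratics in a half plane -/

/-- Numbers in the half plane `1/2 < Re z` have a generalised standard deviation `s` such that
`m ± s` stay in this half plane, `m` being their mean. -/
theorem exists_sqrt_variance {ι : Type*} [Fintype ι] [Nonempty ι] (u : ι → ℂ)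
    (hu : ∀ i, 1 / 2 < (u i).re) (m : ℂ) (hm : (Fintype.card ι : ℂ) * m = ∑ i, u i) :
    ∃ s : ℂ, (Fintype.card ι : ℂ) * ((Fintype.card ι : ℂ) - 1) * s ^ 2 = ∑ i, (u i - m) ^ 2 ∧
      |s.re| < m.re - 1 / 2 := by
  have hcard : 1 ≤ Fintype.card ι := Fintype.card_pos
  have hmre : (Fintype.card ι : ℝ) * m.re = ∑ i, (u i).re := by
    have := congrArg Complex.re hm
    simpa using this
  rcases hcard.eq_or_lt with h1 | h2
  · obtain ⟨i₀, hi₀⟩ := Fintype.card_eq_one_iff.1 h1.symm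
    have : Unique ι := ⟨⟨i₀⟩, hi₀⟩
    have hmu : m = u default := by simpa using hm
    refine ⟨0, by simp [hmu], ?_⟩
    have := hu default
    simp only [Complex.zero_re, abs_zero, hmu]
    linarith
  · set n : ℝ := (Fintype.card ι : ℝ) with hn
    have hn2 : 1 < n := by rw [hn]; exact_mod_cast h2
    have hnC : (Fintype.card ι : ℂ) = (n : ℂ) := by simp [hn]
    set N : ℝ := n * (n - 1) with hN
    have hNpos : 0 < N := mul_pos (by linarith) (by linarith)
    obtain ⟨s, hs⟩ := IsAlgClosed.exists_pow_nat_eq ((∑ i, (u i - m) ^ 2) / (N : ℂ)) two_pos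
    have hNC : (N : ℂ) ≠ 0 := by exact_mod_cast hNpos.ne'
    have hs' : (N : ℂ) * s ^ 2 = ∑ i, (u i - m) ^ 2 := by rw [hs]; field_simp
    refine ⟨s, by rw [← hs', hnC, hN]; push_cast; ring, ?_⟩
    set A := ∑ i, (u i - m).re ^ 2 with hA
    set B := ∑ i, (u i - m).im ^ 2 with hB
    set K := ∑ i, (u i - m).re * (u i - m).im with hK
    have hre : N * (s.re ^ 2 - s.im ^ 2) = A - B := by
      have := congrArg Complex.re hs'
      rw [Complex.re_ofReal_mul, Complex.re_sum] at this
      rw [hA, hB, ← Finset.sum_sub_distrib]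
      simpa [pow_two] using this
    have him : N * (s.re * s.im) = K := by
      have := congrArg Complex.im hs'
      rw [Complex.im_ofReal_mul, Complex.im_sum] at this
      have h2 : N * (2 * (s.re * s.im)) = ∑ i, 2 * ((u i - m).re * (u i - m).im) := by
        convert this using 2
        · simp [pow_two]; ring
        · simp [pow_two]; ring
      rw [← Finset.mul_sum] at h2
      linarith
    have hCS : K ^ 2 ≤ A * B := Finset.sum_mul_sq_le_sq_mul_sq _ _ _
    have hB0 : 0 ≤ B := Finset.sum_nonneg fun i _ => sq_nonneg _
    have hA0 : 0 ≤ A := Finset.sum_nonneg fun i _ => sq_nonneg _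
    -- If this failed, `hre` would give `N (Im s)² > B` as well, and the product of the two would
    -- contradict Cauchy–Schwarz.
    have hsA : N * s.re ^ 2 ≤ A := by
      by_contra! hlt
      have h1 : B < N * s.im ^ 2 := by nlinarith
      have h3 : (N * s.re ^ 2) * (N * s.im ^ 2) = K ^ 2 := by rw [← him]; ring
      have h4 : A * B < (N * s.re ^ 2) * (N * s.im ^ 2) :=
        mul_lt_mul'' hlt h1 hA0 hB0
      linarith
    set x : ι → ℝ := fun i => (u i).re - 1 / 2 with hx
    have hxpos : ∀ i, 0 < x i := fun i => by have := hu i; simp only [hx]; linarith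
    have hxsum : ∑ i, x i = n * (m.re - 1 / 2) := by
      simp only [hx, Finset.sum_sub_distrib, ← hmre]
      simp [← hn]; ring
    -- The cross terms are positive, and with at least two indices there are some.
    have hsq : ∑ i, x i ^ 2 < (∑ i, x i) ^ 2 := by
      rw [pow_two (∑ i, x i), Finset.sum_mul]
      refine Finset.sum_lt_sum_of_nonempty Finset.univ_nonempty fun i _ => ?_
      rw [pow_two]
      refine mul_lt_mul_of_pos_left ?_ (hxpos i)
      obtain ⟨j, hj⟩ := Fintype.exists_ne_of_one_lt_card h2 i
      exact Finset.single_lt_sum hj (Finset.mem_univ i) (Finset.mem_univ j) (hxpos j)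
        fun k _ _ => (hxpos k).le
    have hAx : A = ∑ i, x i ^ 2 - n * (m.re - 1 / 2) ^ 2 := by
      have : ∀ i, (u i - m).re ^ 2
          = x i ^ 2 - 2 * (m.re - 1 / 2) * x i + (m.re - 1 / 2) ^ 2 := fun i => by
        simp only [hx, Complex.sub_re]; ring
      rw [hA, Finset.sum_congr rfl fun i _ => this i, Finset.sum_add_distrib,
        Finset.sum_sub_distrib, ← Finset.mul_sum, hxsum]
      simp [← hn]; ring
    have hpos : 0 < m.re - 1 / 2 := by
      have : 0 < ∑ i, x i := Finset.sum_pos (fun i _ => hxpos i) Finset.univ_nonempty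
      rw [hxsum] at this
      exact pos_of_mul_pos_right this (by linarith)
    refine abs_lt_of_sq_lt_sq ?_ hpos.le
    rw [hxsum] at hsq
    have : N * s.re ^ 2 < N * (m.re - 1 / 2) ^ 2 := by
      have : N * (m.re - 1 / 2) ^ 2
        = (n * (m.re - 1 / 2)) ^ 2 - n * (m.re - 1 / 2) ^ 2 := by rw [hN]; ring
      linarith
    exact lt_of_mul_lt_mul_left this hNpos.le

/-- Inversion turns the half plane `Re v ≥ d` into the disc `d |w|² ≤ Re w`, whose convexity allows
averaging. -/
theorem re_inv_ge {v : ℂ} {d : ℝ} (hd : 0 < d) (hv : d ≤ v.re) :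
    d * Complex.normSq v⁻¹ ≤ (v⁻¹).re := by
  have hpos : 0 < Complex.normSq v := Complex.normSq_pos.2 fun h => by simp [h] at hv; linarith
  rw [Complex.inv_re, map_inv₀, ← div_eq_mul_inv]
  gcongr

theorem re_ge_of_inv {v : ℂ} {d : ℝ} (h0 : v ≠ 0)
    (hv : d * Complex.normSq v⁻¹ ≤ (v⁻¹).re) : d ≤ v.re := by
  have hpos : 0 < Complex.normSq v := Complex.normSq_pos.2 h0
  rw [Complex.inv_re, map_inv₀, ← div_eq_mul_inv] at hv
  exact (div_le_div_iff_of_pos_right hpos).1 hv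

/-- The quadratic case of the Grace–Walsh–Szegő coincidence theorem for a half plane. -/
theorem polarized_quadratic_ne_zero {a b c : ℂ}
    (h : ∀ u : ℂ, a + b * u + c * u ^ 2 = 0 → u.re ≤ 1 / 2) {m s : ℂ}
    (hs : |s.re| < m.re - 1 / 2) : a + b * m + c * (m ^ 2 - s ^ 2) ≠ 0 := by
  intro h0
  obtain ⟨hs1, hs2⟩ := abs_lt.1 hs
  by_cases hc : c = 0
  · have := h m (by rw [← h0, hc]; ring)
    linarith
  obtain ⟨t, ht⟩ := IsAlgClosed.exists_pow_nat_eq (b ^ 2 - 4 * a * c) two_pos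
  obtain ⟨p, hp⟩ : ∃ p, p = (-b + t) / (2 * c) := ⟨_, rfl⟩
  obtain ⟨q, hq⟩ : ∃ q, q = (-b - t) / (2 * c) := ⟨_, rfl⟩
  have hb : b = -c * (p + q) := by rw [hp, hq]; field_simp; ring
  have ha : a = c * (p * q) := by
    rw [hp, hq]; field_simp; linear_combination ht
  have hp' := h p (by rw [ha, hb]; ring)
  have hq' := h q (by rw [ha, hb]; ring)
  have hd : 0 < (m + s).re - 1 / 2 := by simp only [Complex.add_re]; linarith
  -- The expression is the polarisation of `c (u - p)(u - q)` at the points `m + s` and `m - s`.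
  have key : (m + s - p) * (m - s - q) + (m + s - q) * (m - s - p) = 0 := by
    refine mul_left_cancel₀ hc ?_
    rw [ha, hb] at h0
    linear_combination 2 * h0
  have e1 := re_inv_ge hd (v := m + s - p) (by simp only [Complex.sub_re]; linarith)
  have e2 := re_inv_ge hd (v := m + s - q) (by simp only [Complex.sub_re]; linarith)
  have n1 : m + s - p ≠ 0 := fun h => by
    have := congrArg Complex.re h
    simp at this hd; linarith
  have n2 : m + s - q ≠ 0 := fun h => by
    have := congrArg Complex.re h
    simp at this hd; linarith
  -- So `1/(2s)` is the mean of two points of the disc with parameter `d = Re(m + s) - 1/2`.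
  -- Inverting back gives `2 Re s ≥ d`, that is `Re s ≥ Re m - 1/2`, a contradiction.
  have hw : (2 * s) * (((m + s - p)⁻¹ + (m + s - q)⁻¹) / 2) = 1 := by
    field_simp
    linear_combination (-1 / 2 : ℂ) * key
  have hs0 : 2 * s ≠ 0 := left_ne_zero_of_mul_eq_one hw
  have hinv : (2 * s)⁻¹ = ((m + s - p)⁻¹ + (m + s - q)⁻¹) / 2 := inv_eq_of_mul_eq_one_right hw
  have := re_ge_of_inv (d := (m + s).re - 1 / 2) hs0 (by
    rw [hinv]
    set w₁ := (m + s - p)⁻¹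
    set w₂ := (m + s - q)⁻¹
    set d := (m + s).re - 1 / 2
    have r : ((w₁ + w₂) / 2).re = (w₁.re + w₂.re) / 2 := by simp
    have i : ((w₁ + w₂) / 2).im = (w₁.im + w₂.im) / 2 := by simp
    rw [Complex.normSq_apply] at e1 e2 ⊢
    rw [r, i]
    nlinarith [mul_nonneg hd.le (sq_nonneg (w₁.re - w₂.re)),
      mul_nonneg hd.le (sq_nonneg (w₁.im - w₂.im))])
  simp at this
  linarith

/-! ### Rahman's operators and the location of zeros -/

theorem eval_derivatives_prod_X_sub_C {ι : Type*} (t : Finset ι) (z : ι → ℂ) (w : ℂ)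
    (hw : ∀ i ∈ t, w - z i ≠ 0) :
    (derivative (∏ i ∈ t, (X - C (z i)))).eval w
        = (∏ i ∈ t, (X - C (z i))).eval w * ∑ i ∈ t, (w - z i)⁻¹ ∧
      (derivative (derivative (∏ i ∈ t, (X - C (z i))))).eval w
        = (∏ i ∈ t, (X - C (z i))).eval w
          * ((∑ i ∈ t, (w - z i)⁻¹) ^ 2 - ∑ i ∈ t, ((w - z i)⁻¹) ^ 2) := by
  classical
  induction t using Finset.induction_on with
  | empty => simp
  | insert a t ha ih =>
    obtain ⟨i1, i2⟩ := ih fun i hi => hw i (Finset.mem_insert_of_mem hi)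
    have h0 := hw a (Finset.mem_insert_self a t)
    rw [Finset.prod_insert ha, Finset.sum_insert ha, Finset.sum_insert ha]
    simp only [derivative_mul, derivative_sub, derivative_X, derivative_C, sub_zero, one_mul,
      derivative_add, eval_add, eval_mul, eval_sub, eval_X, eval_C, i1, i2]
    constructor
    · field_simp
    · field_simp
      ring

theorem re_gt_half_of_norm_lt {w z : ℂ} (h : ‖z‖ < ‖w‖) : 1 / 2 < (w * (w - z)⁻¹).re := by
  have hne : w - z ≠ 0 := fun e => by rw [sub_eq_zero.1 e] at h; exact lt_irrefl _ h
  have hpos := Complex.normSq_pos.2 hne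
  have h2 : Complex.normSq z < Complex.normSq w := by
    rw [Complex.normSq_eq_norm_sq, Complex.normSq_eq_norm_sq]; gcongr
  have e : (w * (w - z)⁻¹).re
      = (w.re * (w.re - z.re) + w.im * (w.im - z.im)) / Complex.normSq (w - z) := by
    simp [Complex.mul_re, Complex.inv_re, Complex.inv_im]; ring
  rw [e, lt_div_iff₀ hpos]
  simp only [Complex.normSq_apply, Complex.sub_re, Complex.sub_im] at h2 ⊢
  nlinarith

theorem exists_eq_C_mul_prod (P : ℂ[X]) :
    ∃ (ι : Type) (_ : Fintype ι) (z : ι → ℂ), Fintype.card ι = P.natDegree ∧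
      P = C P.leadingCoeff * ∏ i, (X - C (z i)) := by
  classical
  have hs := IsAlgClosed.splits P
  refine ⟨P.roots, inferInstance, fun x => (x : ℂ), ?_, ?_⟩
  · rw [Multiset.card_coe]; exact hs.natDegree_eq_card_roots.symm
  · conv_lhs => rw [hs.eq_prod_roots]
    congr 1
    exact congrArg Multiset.prod (Multiset.map_univ P.roots fun a => X - C a).symm

/-- Rahman's operators preserve the polynomials of degree `n` all of whose zeros lie in a
disc centred at the origin. -/
theorem rahmanB_eval_ne_zero {n : ℕ} (hn : 0 < n) {l₀ l₁ l₂ : ℂ}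
    (hB : RahmanAdmissible n l₀ l₁ l₂) {P : ℂ[X]} (hdeg : P.natDegree = n) {w : ℂ}
    (hP : ∀ z, P.eval z = 0 → ‖z‖ < ‖w‖) : (rahmanB n l₀ l₁ l₂ P).eval w ≠ 0 := by
  obtain ⟨ι, _, z, hcard, hfac⟩ := exists_eq_C_mul_prod P
  rw [hdeg] at hcard
  have : Nonempty ι := Fintype.card_pos_iff.1 (hcard ▸ hn)
  have hz : ∀ i, ‖z i‖ < ‖w‖ := fun i => hP _ (by
    rw [hfac, eval_mul, eval_prod, Finset.prod_eq_zero (Finset.mem_univ i) (by simp), mul_zero])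
  have hne : ∀ i, w - z i ≠ 0 := fun i e => by
    have := hz i; rw [sub_eq_zero.1 e] at this; exact lt_irrefl _ this
  have hPw : P.eval w ≠ 0 := fun h => lt_irrefl _ (hP w h)
  obtain ⟨d1, d2⟩ := eval_derivatives_prod_X_sub_C Finset.univ z w fun i _ => hne i
  set u : ι → ℂ := fun i => w * (w - z i)⁻¹ with hu
  have hn0 : (n : ℂ) ≠ 0 := by exact_mod_cast hn.ne'
  have hcC : (Fintype.card ι : ℂ) = n := by rw [hcard]
  obtain ⟨m, hm⟩ : ∃ m, m = (∑ i, u i) / n := ⟨_, rfl⟩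
  have hm' : (n : ℂ) * m = ∑ i, u i := by rw [hm]; field_simp
  obtain ⟨s, hs, hsre⟩ := exists_sqrt_variance u (fun i => re_gt_half_of_norm_lt (hz i)) m
    (by rw [hcC, hm'])
  rw [hcC] at hs
  have hvar : ∑ i, (u i - m) ^ 2 = ∑ i, u i ^ 2 - n * m ^ 2 := by
    have : ∀ i, (u i - m) ^ 2 = u i ^ 2 - 2 * m * u i + m ^ 2 := fun i => by ring
    rw [Finset.sum_congr rfl fun i _ => this i, Finset.sum_add_distrib, Finset.sum_sub_distrib,
      ← Finset.mul_sum, ← hm']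
    simp [hcC]; ring
  have hd1 : w * (derivative P).eval w = P.eval w * (n * m) := by
    have : w * ∑ i, (w - z i)⁻¹ = ∑ i, u i := by rw [Finset.mul_sum]
    rw [hm', ← this]
    conv_lhs => rw [hfac]
    conv_rhs => rw [hfac]
    rw [derivative_C_mul, eval_C_mul, eval_C_mul, d1]; ring
  have hd2 : w ^ 2 * (derivative (derivative P)).eval w
      = P.eval w * ((n * m) ^ 2 - ∑ i, u i ^ 2) := by
    have e1 : w * ∑ i, (w - z i)⁻¹ = ∑ i, u i := by rw [Finset.mul_sum]
    have e2 : w ^ 2 * ∑ i, ((w - z i)⁻¹) ^ 2 = ∑ i, u i ^ 2 := by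
      rw [Finset.mul_sum]; simp only [hu, mul_pow]
    rw [hm', ← e1, ← e2]
    conv_lhs => rw [hfac]
    conv_rhs => rw [hfac]
    rw [derivative_C_mul, derivative_C_mul, eval_C_mul, eval_C_mul, d2]; ring
  -- By `hvar` and `hs`, `(nm)² - ∑ uᵢ² = n(n-1)(m² - s²)`. The coefficients are those of `U(nv/2)`
  -- in `v`.
  have hval : (rahmanB n l₀ l₁ l₂ P).eval w = P.eval w *
      (l₀ + (n : ℂ) ^ 2 / 2 * l₁ * m
        + (n : ℂ) ^ 3 * (n - 1) / 8 * l₂ * (m ^ 2 - s ^ 2)) := by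
    simp only [rahmanB, eval_add, eval_mul, eval_C, eval_X, eval_pow]
    linear_combination l₁ * n / 2 * hd1 + l₂ * n ^ 2 / 8 * hd2
      + P.eval w * l₂ * n ^ 2 / 8 * (hvar + hs)
  rw [hval]
  refine mul_ne_zero hPw (polarized_quadratic_ne_zero (fun v hv => ?_) hsre)
  have hU : (rahmanU n l₀ l₁ l₂).eval (n * v / 2) = 0 := by
    rw [← hv]
    simp only [rahmanU, eval_add, eval_mul, eval_C, eval_X, eval_pow]; ring
  have hle := hB _ hU
  have hsq : Complex.normSq ((n : ℂ) * v / 2) ≤ Complex.normSq ((n : ℂ) * v / 2 - n / 2) := by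
    rw [Complex.normSq_eq_norm_sq, Complex.normSq_eq_norm_sq]; gcongr
  have e1 : (n : ℂ) * v / 2 = ((n / 2 : ℝ) : ℂ) * v := by push_cast; ring
  have e2 : (n : ℂ) * v / 2 - n / 2 = ((n / 2 : ℝ) : ℂ) * (v - 1) := by push_cast; ring
  rw [e2, e1, map_mul, map_mul] at hsq
  have hpos : 0 < Complex.normSq ((n / 2 : ℝ) : ℂ) := by
    rw [Complex.normSq_ofReal]; positivity
  have := le_of_mul_le_mul_left hsq hpos
  simp only [Complex.normSq_apply, Complex.sub_re, Complex.sub_im, Complex.one_re,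
    Complex.one_im] at this
  linarith

/-! ### Conjugate reciprocal polynomials -/

/-- The conjugate reciprocal polynomial `z ↦ zⁿ conj (P (1 / conj z))`. -/
noncomputable def conjReflect (n : ℕ) (P : ℂ[X]) : ℂ[X] := reflect n (P.map (starRingEnd ℂ))

theorem natDegree_conjReflect_le {n : ℕ} {P : ℂ[X]} (hP : P.natDegree ≤ n) :
    (conjReflect n P).natDegree ≤ n :=
  natDegree_reflect_le.trans (max_le le_rfl (natDegree_map_le.trans hP))

theorem conjReflect_conjReflect (n : ℕ) (P : ℂ[X]) : conjReflect n (conjReflect n P) = P := by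
  rw [conjReflect, conjReflect, ← reflect_map, reflect_reflect, Polynomial.map_map]
  have : (starRingEnd ℂ).comp (starRingEnd ℂ) = RingHom.id ℂ := by ext x; simp
  rw [this, Polynomial.map_id]

theorem conjReflect_sub (n : ℕ) (P Q : ℂ[X]) :
    conjReflect n (P - Q) = conjReflect n P - conjReflect n Q := by
  simp only [conjReflect, sub_eq_add_neg, reflect_add, reflect_neg,
    Polynomial.map_add, Polynomial.map_neg]

theorem conjReflect_C_mul (n : ℕ) (c : ℂ) (P : ℂ[X]) :
    conjReflect n (C c * P) = C (starRingEnd ℂ c) * conjReflect n P := by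
  rw [conjReflect, conjReflect, Polynomial.map_mul, map_C, reflect_C_mul]

theorem conjReflect_C (n : ℕ) (c : ℂ) :
    conjReflect n (C c) = C (starRingEnd ℂ c) * X ^ n := by
  rw [conjReflect, map_C, reflect_C]

theorem eval_conjReflect {n : ℕ} {P : ℂ[X]} (hP : P.natDegree ≤ n) {w : ℂ} (hw : w ≠ 0) :
    (conjReflect n P).eval w
      = w ^ n * starRingEnd ℂ (P.eval (starRingEnd ℂ w⁻¹)) := by
  let _ := invertibleOfNonzero (inv_ne_zero hw)
  have h := eval₂_reflect_mul_pow (RingHom.id ℂ) w⁻¹ n (P.map (starRingEnd ℂ))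
    (natDegree_map_le.trans hP)
  have h2 : (P.map (starRingEnd ℂ)).eval w⁻¹
      = starRingEnd ℂ (P.eval (starRingEnd ℂ w⁻¹)) := by
    have := eval_map_apply (f := starRingEnd ℂ) (p := P) (starRingEnd ℂ w⁻¹)
    rwa [Complex.conj_conj] at this
  rw [invOf_eq_inv, inv_inv, eval₂_id, eval₂_id, h2] at h
  rw [conjReflect, ← h, mul_comm, mul_assoc, ← mul_pow, inv_mul_cancel₀ hw, one_pow, mul_one]

theorem norm_eval_conjReflect {n : ℕ} {P : ℂ[X]} (hP : P.natDegree ≤ n) {w : ℂ}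
    (hw : ‖w‖ = 1) : ‖(conjReflect n P).eval w‖ = ‖P.eval w‖ := by
  have hw0 : w ≠ 0 := fun h => by simp [h] at hw
  rw [eval_conjReflect hP hw0, norm_mul, norm_pow, hw, one_pow, one_mul, RCLike.norm_conj,
    Complex.inv_eq_conj hw, Complex.conj_conj]

/-- The coefficient of `zⁿ` is the conjugate of `P(0)`. This supplies the exact degree that
`rahmanB_eval_ne_zero` needs, even if `deg P < n`. -/
theorem natDegree_conjReflect {n : ℕ} {P : ℂ[X]} (hP : P.natDegree ≤ n) (h0 : P.eval 0 ≠ 0) :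
    (conjReflect n P).natDegree = n := by
  refine natDegree_eq_of_le_of_coeff_ne_zero (natDegree_conjReflect_le hP) ?_
  rw [conjReflect, coeff_reflect, revAt_le le_rfl, Nat.sub_self, coeff_map,
    coeff_zero_eq_eval_zero]
  simpa using h0

theorem norm_lt_one_of_eval_conjReflect_eq_zero {n : ℕ} {P : ℂ[X]} (hP : P.natDegree ≤ n)
    (hne : ∀ z : ℂ, ‖z‖ ≤ 1 → P.eval z ≠ 0) {w : ℂ} (hw : (conjReflect n P).eval w = 0) :
    ‖w‖ < 1 := by
  by_contra! h
  have hw0 : w ≠ 0 := fun e => by rw [e, norm_zero] at h; linarith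
  rw [eval_conjReflect hP hw0, mul_eq_zero, map_eq_zero] at hw
  refine hne _ ?_ (hw.resolve_left (pow_ne_zero _ hw0))
  rw [RCLike.norm_conj, norm_inv]
  exact inv_le_one_of_one_le₀ h

/-! ### Algebra of the operator and of the functional -/

theorem rahmanB_sub (n : ℕ) (l₀ l₁ l₂ : ℂ) (P Q : ℂ[X]) :
    rahmanB n l₀ l₁ l₂ (P - Q) = rahmanB n l₀ l₁ l₂ P - rahmanB n l₀ l₁ l₂ Q := by
  simp only [rahmanB, derivative_sub]; ring

theorem rahmanB_C_mul (n : ℕ) (l₀ l₁ l₂ c : ℂ) (P : ℂ[X]) :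
    rahmanB n l₀ l₁ l₂ (C c * P) = C c * rahmanB n l₀ l₁ l₂ P := by
  simp only [rahmanB, derivative_C_mul]; ring

theorem eval_dilate (P : ℂ[X]) (s : ℝ) (z : ℂ) : (dilate P s).eval z = P.eval (s * z) := by
  simp [dilate]

theorem eval_rahmanB_dilate (n : ℕ) (l₀ l₁ l₂ : ℂ) (P : ℂ[X]) (s : ℝ) (z : ℂ) :
    (rahmanB n l₀ l₁ l₂ (dilate P s)).eval z = (rahmanB n l₀ l₁ l₂ P).eval (s * z) := by
  simp only [rahmanB, dilate, derivative_comp, derivative_X, mul_one,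
    derivative_mul, derivative_C, zero_mul, zero_add, eval_add, eval_mul, eval_C, eval_X,
    eval_pow, eval_comp]
  ring

theorem eval_rahmanB_X_pow (n : ℕ) (l₀ l₁ l₂ : ℂ) (z : ℂ) :
    (rahmanB n l₀ l₁ l₂ (X ^ n)).eval z
      = (l₀ + (n : ℂ) ^ 2 / 2 * l₁ + (n : ℂ) ^ 3 * (n - 1) / 8 * l₂) * z ^ n := by
  -- The exponents `n - 1` and `n - 2` are truncated for small `n`.
  rcases n with _ | _ | n
  · simp [rahmanB]
  · simp [rahmanB]; ring
  · simp [rahmanB]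
    ring

/-- The functional `P ↦ B[P](Rz) - α B[P](rz)`. -/
noncomputable def dilationDiff (n : ℕ) (l₀ l₁ l₂ α : ℂ) (R r : ℝ) (z : ℂ) (P : ℂ[X]) : ℂ :=
  (rahmanB n l₀ l₁ l₂ P).eval (R * z) - α * (rahmanB n l₀ l₁ l₂ P).eval (r * z)

section dilationDiff

variable {n : ℕ} {l₀ l₁ l₂ α : ℂ} {R r : ℝ} {z : ℂ}

theorem dilationDiff_sub (P Q : ℂ[X]) :
    dilationDiff n l₀ l₁ l₂ α R r z (P - Q)
      = dilationDiff n l₀ l₁ l₂ α R r z P - dilationDiff n l₀ l₁ l₂ α R r z Q := by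
  simp only [dilationDiff, rahmanB_sub, eval_sub]; ring

theorem dilationDiff_C_mul (c : ℂ) (P : ℂ[X]) :
    dilationDiff n l₀ l₁ l₂ α R r z (C c * P) = c * dilationDiff n l₀ l₁ l₂ α R r z P := by
  simp only [dilationDiff, rahmanB_C_mul, eval_mul, eval_C]; ring

theorem dilationDiff_C (c : ℂ) :
    dilationDiff n l₀ l₁ l₂ α R r z (C c) = c * dilationDiff n l₀ l₁ l₂ α R r z 1 := by
  rw [← dilationDiff_C_mul, mul_one]

theorem dilationDiff_one : dilationDiff n l₀ l₁ l₂ α R r z 1 = (1 - α) * l₀ := by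
  simp [dilationDiff, rahmanB]; ring

theorem dilationDiff_X_pow : dilationDiff n l₀ l₁ l₂ α R r z (X ^ n)
    = (rahmanB n l₀ l₁ l₂ (X ^ n)).eval z * ((R : ℂ) ^ n - α * (r : ℂ) ^ n) := by
  simp only [dilationDiff, eval_rahmanB_X_pow, mul_pow]; ring

theorem norm_dilationDiff (P : ℂ[X]) :
    ‖dilationDiff n l₀ l₁ l₂ α R r z P‖ = lhsAt n l₀ l₁ l₂ α R r P z := by
  rw [lhsAt, eval_rahmanB_dilate, eval_rahmanB_dilate, dilationDiff]

/-! ### Dilations, nonvanishing and comparison -/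

theorem norm_sub_lt_of_dilation {w ρ : ℂ} (hw : 1 ≤ ‖w‖) (hρ : ‖ρ‖ < 1) (hr : 1 ≤ r)
    (hR : r < R) : ‖r * w - ρ‖ < ‖R * w - ρ‖ := by
  have h : Complex.normSq ρ < Complex.normSq w := by
    rw [Complex.normSq_eq_norm_sq, Complex.normSq_eq_norm_sq]
    have := norm_nonneg ρ
    nlinarith
  refine lt_of_pow_lt_pow_left₀ 2 (norm_nonneg _) ?_
  rw [← Complex.normSq_eq_norm_sq, ← Complex.normSq_eq_norm_sq]
  simp only [Complex.normSq_apply, Complex.sub_re, Complex.sub_im, Complex.re_ofReal_mul,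
    Complex.im_ofReal_mul] at h ⊢
  have h1 : 2 * (w.re * ρ.re + w.im * ρ.im) < 2 * (w.re * w.re + w.im * w.im) := by
    nlinarith [sq_nonneg (w.re - ρ.re), sq_nonneg (w.im - ρ.im)]
  have h2 : 2 * (w.re * w.re + w.im * w.im) ≤ (R + r) * (w.re * w.re + w.im * w.im) :=
    mul_le_mul_of_nonneg_right (by linarith)
      (add_nonneg (mul_self_nonneg _) (mul_self_nonneg _))
  have h3 := mul_pos (sub_pos.2 hR) (sub_pos.2 (h1.trans_le h2))
  linarith

theorem norm_eval_lt_of_dilation {P : ℂ[X]} (hdeg : 0 < P.natDegree)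
    (hP : ∀ z, P.eval z = 0 → ‖z‖ < 1) (hr : 1 ≤ r) (hR : r < R) {w : ℂ} (hw : 1 ≤ ‖w‖) :
    ‖P.eval (r * w)‖ < ‖P.eval (R * w)‖ := by
  obtain ⟨ι, _, ζ, hcard, hfac⟩ := exists_eq_C_mul_prod P
  have : Nonempty ι := Fintype.card_pos_iff.1 (hcard ▸ hdeg)
  have hζ : ∀ i, ‖ζ i‖ < 1 := fun i => hP _ (by
    rw [hfac, eval_mul, eval_prod, Finset.prod_eq_zero (Finset.mem_univ i) (by simp), mul_zero])
  have hlc : P.leadingCoeff ≠ 0 := fun h => by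
    rw [leadingCoeff_eq_zero.1 h, natDegree_zero] at hdeg; exact lt_irrefl _ hdeg
  rw [hfac]
  simp only [eval_mul, eval_C, eval_prod, eval_sub, eval_X, norm_mul, norm_prod]
  refine mul_lt_mul_of_pos_left ?_ (norm_pos_iff.2 hlc)
  refine Finset.prod_lt_prod_of_nonempty (fun i _ => ?_)
    (fun i _ => norm_sub_lt_of_dilation hw (hζ i) hr hR) Finset.univ_nonempty
  refine norm_pos_iff.2 fun e => ?_
  have h1 : ‖(r : ℂ) * w‖ = ‖ζ i‖ := by rw [sub_eq_zero.1 e]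
  rw [norm_mul, Complex.norm_real, Real.norm_of_nonneg (by linarith)] at h1
  have := hζ i
  nlinarith

/-- With `F = P*`, the polynomial `F(Rw) - α F(rw)` has degree `n` and cannot vanish for `|w| ≥ 1`,
where `|F(rw)| < |F(Rw)|`. So `B` of it is nonzero on the unit circle. -/
theorem dilationDiff_conjReflect_ne_zero (hn : 0 < n) (hB : RahmanAdmissible n l₀ l₁ l₂)
    (hα : ‖α‖ ≤ 1) (hr : 1 ≤ r) (hR : r < R) (hz : ‖z‖ = 1) {P : ℂ[X]} (hP : P.natDegree ≤ n)
    (hne : ∀ z : ℂ, ‖z‖ ≤ 1 → P.eval z ≠ 0) :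
    dilationDiff n l₀ l₁ l₂ α R r z (conjReflect n P) ≠ 0 := by
  set F := conjReflect n P with hF
  have hFdeg : F.natDegree = n := natDegree_conjReflect hP (hne 0 (by simp))
  have hFz : ∀ w, F.eval w = 0 → ‖w‖ < 1 := fun w hw =>
    norm_lt_one_of_eval_conjReflect_eq_zero hP hne hw
  have hFn : F.coeff n ≠ 0 := by
    rw [← hFdeg, coeff_natDegree, Ne, leadingCoeff_eq_zero]
    intro h; rw [h, natDegree_zero] at hFdeg; omega
  set G := dilate F R - C α * dilate F r with hG
  have hGF : dilationDiff n l₀ l₁ l₂ α R r z F = (rahmanB n l₀ l₁ l₂ G).eval z := by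
    rw [dilationDiff, hG, rahmanB_sub, rahmanB_C_mul, eval_sub, eval_mul, eval_C,
      eval_rahmanB_dilate, eval_rahmanB_dilate]
  have hGdeg : G.natDegree = n := by
    have hd : ∀ s : ℝ, (dilate F s).natDegree ≤ n := fun s => by
      refine natDegree_comp_le.trans ?_
      rw [hFdeg]
      exact (Nat.mul_le_mul_left n (natDegree_C_mul_le _ X)).trans (by simp)
    refine natDegree_eq_of_le_of_coeff_ne_zero
      ((natDegree_sub_le _ _).trans (max_le (hd R) ((natDegree_C_mul_le _ _).trans (hd r)))) ?_
    rw [hG, coeff_sub, coeff_C_mul, dilate, dilate, comp_C_mul_X_coeff, comp_C_mul_X_coeff]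
    intro h
    have h1 : (R : ℂ) ^ n = α * (r : ℂ) ^ n := by
      refine mul_left_cancel₀ hFn ?_
      linear_combination h
    have h2 := congrArg norm h1
    rw [norm_mul, norm_pow, norm_pow, Complex.norm_real, Complex.norm_real,
      Real.norm_of_nonneg (by linarith), Real.norm_of_nonneg (by linarith)] at h2
    have h3 : r ^ n < R ^ n := pow_lt_pow_left₀ hR (by linarith) hn.ne'
    have h4 : ‖α‖ * r ^ n ≤ 1 * r ^ n :=
      mul_le_mul_of_nonneg_right hα (pow_nonneg (by linarith) n)
    linarith
  rw [hGF]
  refine rahmanB_eval_ne_zero hn hB hGdeg fun w hw => ?_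
  rw [hz]
  by_contra! hw1
  rw [hG, eval_sub, eval_mul, eval_C, eval_dilate, eval_dilate, sub_eq_zero] at hw
  have h1 := norm_eval_lt_of_dilation (hFdeg ▸ hn) hFz hr hR hw1
  rw [hw, norm_mul] at h1
  have := mul_le_mul_of_nonneg_right hα (norm_nonneg (F.eval (r * w)))
  linarith

theorem norm_eval_le_of_norm_eval_le_on_circle {f g : ℂ[X]}
    (hfg : ∀ w : ℂ, ‖w‖ = 1 → ‖f.eval w‖ ≤ ‖g.eval w‖)
    (hg : ∀ w : ℂ, ‖w‖ ≤ 1 → g.eval w ≠ 0) {w : ℂ} (hw : ‖w‖ ≤ 1) :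
    ‖f.eval w‖ ≤ ‖g.eval w‖ := by
  have hcl : closure (Metric.ball (0 : ℂ) 1) = Metric.closedBall 0 1 :=
    closure_ball 0 one_ne_zero
  have h : ‖f.eval w / g.eval w‖ ≤ 1 := by
    refine Complex.norm_le_of_forall_mem_frontier_norm_le
      (f := fun v => f.eval v / g.eval v) (U := Metric.ball 0 1) Metric.isBounded_ball ?_ ?_ ?_
    · refine DifferentiableOn.diffContOnCl ?_
      rw [hcl]
      exact f.differentiable.differentiableOn.div g.differentiable.differentiableOn
        fun v hv => hg v (by simpa using hv)
    · intro v hv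
      rw [frontier_ball 0 one_ne_zero, mem_sphere_zero_iff_norm] at hv
      rw [norm_div]
      exact div_le_one_of_le₀ (hfg v hv) (norm_nonneg _)
    · rw [hcl]; simpa using hw
  rwa [norm_div, div_le_one (norm_pos_iff.2 (hg w hw))] at h

/-- If `|L(f*)| > |L(g*)|`, put `β = L(f*)/L(g*)`. Then `conj β g - f` is zero-free in the closed
disc, yet `L` kills its reciprocal `β g* - f*`. -/
theorem norm_dilationDiff_conjReflect_le (hn : 0 < n) (hB : RahmanAdmissible n l₀ l₁ l₂)
    (hα : ‖α‖ ≤ 1) (hr : 1 ≤ r) (hR : r < R) (hz : ‖z‖ = 1) {f g : ℂ[X]}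
    (hf : f.natDegree ≤ n) (hg : g.natDegree ≤ n)
    (hfg : ∀ w : ℂ, ‖w‖ = 1 → ‖f.eval w‖ ≤ ‖g.eval w‖)
    (hne : ∀ w : ℂ, ‖w‖ ≤ 1 → g.eval w ≠ 0) :
    ‖dilationDiff n l₀ l₁ l₂ α R r z (conjReflect n f)‖
      ≤ ‖dilationDiff n l₀ l₁ l₂ α R r z (conjReflect n g)‖ := by
  have hg0 := dilationDiff_conjReflect_ne_zero hn hB hα hr hR hz hg hne
  set a := dilationDiff n l₀ l₁ l₂ α R r z (conjReflect n f) with ha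
  set b := dilationDiff n l₀ l₁ l₂ α R r z (conjReflect n g) with hb
  by_contra! hlt
  have hβ : 1 < ‖a / b‖ := by rwa [norm_div, one_lt_div (norm_pos_iff.2 hg0)]
  refine dilationDiff_conjReflect_ne_zero hn hB hα hr hR hz
    (P := C (starRingEnd ℂ (a / b)) * g - f)
    ((natDegree_sub_le _ _).trans (max_le ((natDegree_C_mul_le _ _).trans hg) hf))
    (fun w hw h => ?_) ?_
  · rw [eval_sub, eval_mul, eval_C, sub_eq_zero] at h
    have h1 := norm_eval_le_of_norm_eval_le_on_circle hfg hne hw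
    rw [← h, norm_mul, RCLike.norm_conj] at h1
    have := norm_pos_iff.2 (hne w hw)
    nlinarith
  · rw [conjReflect_sub, conjReflect_C_mul, Complex.conj_conj, dilationDiff_sub,
      dilationDiff_C_mul, ← ha, ← hb, div_mul_cancel₀ _ hg0, sub_self]

/-- The unimodular `e` rotates `y` onto the ray of `x`; one `e` serves every real `s`. -/
theorem exists_norm_eq_one_norm_sub (x y : ℂ) :
    ∃ e : ℂ, ‖e‖ = 1 ∧ ∀ s : ℝ, ‖x - s * e * y‖ = |‖x‖ - s * ‖y‖| := by
  by_cases hx : x = 0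
  · exact ⟨1, by simp, fun s => by simp [hx, abs_mul]⟩
  by_cases hy : y = 0
  · exact ⟨1, by simp, fun s => by simp [hy]⟩
  have hx' : (‖x‖ : ℂ) ≠ 0 := by exact_mod_cast norm_ne_zero_iff.2 hx
  refine ⟨x / ‖x‖ * (‖y‖ / y), ?_, fun s => ?_⟩
  · have := norm_ne_zero_iff.2 hx
    have := norm_ne_zero_iff.2 hy
    simp only [norm_mul, norm_div, Complex.norm_real, norm_norm]
    field_simp
  · have : x - s * (x / ‖x‖ * (‖y‖ / y)) * y = x / ‖x‖ * ((‖x‖ - s * ‖y‖ : ℝ) : ℂ) := by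
      push_cast; field_simp
    rw [this, norm_mul, norm_div, Complex.norm_real, Complex.norm_real, norm_norm,
      div_self (norm_ne_zero_iff.2 hx), one_mul, Real.norm_eq_abs]

theorem le_of_forall_mul_le {x y : ℝ} (h : ∀ t : ℝ, 0 ≤ t → t < 1 → t * x ≤ y) : x ≤ y := by
  have hy : 0 ≤ y := by simpa using h 0 le_rfl one_pos
  by_contra! hlt
  have hx : 0 < x := hy.trans_lt hlt
  have := h ((x + y) / (2 * x)) (by positivity) (by rw [div_lt_one (by positivity)]; linarith)
  have e : (x + y) / (2 * x) * x = (x + y) / 2 := by field_simp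
  linarith

theorem le_of_forall_le_mul {x y : ℝ} (hy : 0 ≤ y) (h : ∀ t : ℝ, 1 < t → x ≤ y * t) : x ≤ y :=
  (le_iff_forall_one_lt_le_mul₀ hy).2 h

/-! ### The inequality -/

theorem norm_dilationDiff_le_of_ne_zero (hn : 0 < n) (hB : RahmanAdmissible n l₀ l₁ l₂)
    (hα : ‖α‖ ≤ 1) (hr : 1 ≤ r) (hR : r < R) (hz : ‖z‖ = 1) {p : ℂ[X]}
    (hp : p.natDegree ≤ n) (hne : ∀ w : ℂ, ‖w‖ ≤ 1 → p.eval w ≠ 0) {M m : ℝ} (hm0 : 0 ≤ m)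
    (hM : ∀ w : ℂ, ‖w‖ = 1 → ‖p.eval w‖ ≤ M) (hm : ∀ w : ℂ, ‖w‖ = 1 → m ≤ ‖p.eval w‖) :
    ‖dilationDiff n l₀ l₁ l₂ α R r z p‖ ≤ 1 / 2 *
      ((‖dilationDiff n l₀ l₁ l₂ α R r z (X ^ n)‖ + ‖dilationDiff n l₀ l₁ l₂ α R r z 1‖) * M
      - (‖dilationDiff n l₀ l₁ l₂ α R r z (X ^ n)‖
          - ‖dilationDiff n l₀ l₁ l₂ α R r z 1‖) * m) := by
  have cmp := fun {f g : ℂ[X]} => norm_dilationDiff_conjReflect_le (f := f) (g := g)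
    hn hB hα hr hR hz
  have hCX : ∀ c : ℂ, ‖dilationDiff n l₀ l₁ l₂ α R r z (conjReflect n (C c))‖
      = ‖c‖ * ‖dilationDiff n l₀ l₁ l₂ α R r z (X ^ n)‖ := fun c => by
    rw [conjReflect_C, dilationDiff_C_mul, norm_mul, RCLike.norm_conj]
  have hself : ∀ g : ℂ[X], g.natDegree ≤ n → (∀ w : ℂ, ‖w‖ ≤ 1 → g.eval w ≠ 0) →
      ‖dilationDiff n l₀ l₁ l₂ α R r z g‖
        ≤ ‖dilationDiff n l₀ l₁ l₂ α R r z (conjReflect n g)‖ := fun g hg hg0 => by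
    have := cmp (natDegree_conjReflect_le hg) hg
      (fun w hw => (norm_eval_conjReflect hg hw).le) hg0
    rwa [conjReflect_conjReflect] at this
  have hMpos : 0 < M := (norm_pos_iff.2 (hne 1 (by simp))).trans_le (hM 1 (by simp))
  have hMC : ‖(M : ℂ)‖ = M := by rw [Complex.norm_real, Real.norm_of_nonneg hMpos.le]
  have hmC : ‖(m : ℂ)‖ = m := by rw [Complex.norm_real, Real.norm_of_nonneg hm0]
  have hMball : ∀ w : ℂ, ‖w‖ ≤ 1 → ‖p.eval w‖ ≤ M := fun w hw => by
    have := norm_eval_le_of_norm_eval_le_on_circle (f := p) (g := C (M : ℂ))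
      (fun v hv => by rw [eval_C, hMC]; exact hM v hv)
      (fun v _ => by rw [eval_C]; exact_mod_cast hMpos.ne') hw
    rwa [eval_C, hMC] at this
  have hmball : ∀ w : ℂ, ‖w‖ ≤ 1 → m ≤ ‖p.eval w‖ := fun w hw => by
    have := norm_eval_le_of_norm_eval_le_on_circle (f := C (m : ℂ)) (g := p)
      (fun v hv => by rw [eval_C, hmC]; exact hm v hv) hne hw
    rwa [eval_C, hmC] at this
  have hqM : ‖dilationDiff n l₀ l₁ l₂ α R r z (conjReflect n p)‖
      ≤ M * ‖dilationDiff n l₀ l₁ l₂ α R r z (X ^ n)‖ := by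
    rw [← hMC, ← hCX]
    exact cmp hp ((natDegree_C _).le.trans n.zero_le)
      (fun w hw => by rw [eval_C, hMC]; exact hM w hw)
      (fun w _ => by rw [eval_C]; exact_mod_cast hMpos.ne')
  have hqm : m * ‖dilationDiff n l₀ l₁ l₂ α R r z (X ^ n)‖
      ≤ ‖dilationDiff n l₀ l₁ l₂ α R r z (conjReflect n p)‖ := by
    rw [← hmC, ← hCX]
    exact cmp ((natDegree_C _).le.trans n.zero_le) hp
      (fun w hw => by rw [eval_C, hmC]; exact hm w hw) hne
  obtain ⟨e, he, hes⟩ := exists_norm_eq_one_norm_sub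
    (dilationDiff n l₀ l₁ l₂ α R r z (conjReflect n p)) (dilationDiff n l₀ l₁ l₂ α R r z (X ^ n))
  -- Apply `hself` to `p - conj(τe)`, whose reciprocal is `p* - τe zⁿ`; the choice of `e` makes
  -- `|L|` of the latter exactly the right-hand side.
  have hshift : ∀ τ : ℝ, 0 ≤ τ → (∀ w : ℂ, ‖w‖ ≤ 1 → ‖p.eval w‖ ≠ τ) →
      ‖dilationDiff n l₀ l₁ l₂ α R r z p‖ - τ * ‖dilationDiff n l₀ l₁ l₂ α R r z 1‖
        ≤ |‖dilationDiff n l₀ l₁ l₂ α R r z (conjReflect n p)‖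
            - τ * ‖dilationDiff n l₀ l₁ l₂ α R r z (X ^ n)‖| := fun τ hτ hpτ => by
    have hc : ‖starRingEnd ℂ (τ * e)‖ = τ := by
      rw [RCLike.norm_conj, norm_mul, he, mul_one, Complex.norm_real, Real.norm_of_nonneg hτ]
    have h1 := hself (p - C (starRingEnd ℂ (τ * e)))
      ((natDegree_sub_le _ _).trans (max_le hp ((natDegree_C _).le.trans n.zero_le)))
      (fun w hw h => by
        rw [eval_sub, eval_C, sub_eq_zero] at h
        exact hpτ w hw (by rw [h, hc]))
    rw [conjReflect_sub, conjReflect_C, Complex.conj_conj, dilationDiff_sub, dilationDiff_sub,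
      dilationDiff_C_mul, dilationDiff_C, hes] at h1
    have h2 := norm_sub_norm_le (dilationDiff n l₀ l₁ l₂ α R r z p)
      (starRingEnd ℂ (τ * e) * dilationDiff n l₀ l₁ l₂ α R r z 1)
    rw [norm_mul, hc] at h2
    exact h2.trans h1
  clear hself hCX cmp hes
  set A := ‖dilationDiff n l₀ l₁ l₂ α R r z (X ^ n)‖
  set D := ‖dilationDiff n l₀ l₁ l₂ α R r z 1‖
  set x := ‖dilationDiff n l₀ l₁ l₂ α R r z p‖
  set y := ‖dilationDiff n l₀ l₁ l₂ α R r z (conjReflect n p)‖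
  have hA : 0 ≤ A := norm_nonneg _
  have hD : 0 ≤ D := norm_nonneg _
  -- Here `τ = tM` with `t > 1` tending to 1; `hqM` fixes the sign inside the absolute value.
  have hsum : x + y ≤ (A + D) * M := by
    refine le_of_forall_le_mul (mul_nonneg (add_nonneg hA hD) hMpos.le) fun t ht => ?_
    have hMt : M < t * M := by nlinarith
    have h1 := hshift (t * M) (by linarith) fun w hw => ((hMball w hw).trans_lt hMt).ne
    have h2 : M * A ≤ t * M * A := mul_le_mul_of_nonneg_right hMt.le hA
    rw [abs_of_nonpos (by linarith)] at h1
    linarith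
  -- Here `τ = tm` with `t < 1` tending to 1; `hqm` gives the opposite sign.
  have hdiff : m * (A - D) ≤ y - x := by
    refine le_of_forall_mul_le fun t ht0 ht1 => ?_
    have htm : t * m ≤ m := by nlinarith
    have h1 := hshift (t * m) (by positivity) fun w hw => by
      have h0 := norm_pos_iff.2 (hne w hw)
      have := mul_le_mul_of_nonneg_left (hmball w hw) ht0
      have : t * ‖p.eval w‖ < 1 * ‖p.eval w‖ := mul_lt_mul_of_pos_right ht1 h0
      exact ne_of_gt (by linarith)
    have h2 : t * m * A ≤ m * A := mul_le_mul_of_nonneg_right htm hA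
    rw [abs_of_nonneg (by linarith)] at h1
    linarith
  linarith

/-- The case `k = 1` of the inequality. -/
theorem norm_dilationDiff_le (hn : 0 < n) (hB : RahmanAdmissible n l₀ l₁ l₂)
    (hα : ‖α‖ ≤ 1) (hr : 1 ≤ r) (hR : r < R) (hz : ‖z‖ = 1) {p : ℂ[X]}
    (hp : p.natDegree ≤ n) (hne : ∀ w : ℂ, ‖w‖ < 1 → p.eval w ≠ 0) {M m : ℝ} (hm0 : 0 ≤ m)
    (hM : ∀ w : ℂ, ‖w‖ = 1 → ‖p.eval w‖ ≤ M) (hm : ∀ w : ℂ, ‖w‖ = 1 → m ≤ ‖p.eval w‖) :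
    ‖dilationDiff n l₀ l₁ l₂ α R r z p‖ ≤ 1 / 2 *
      ((‖dilationDiff n l₀ l₁ l₂ α R r z (X ^ n)‖ + ‖dilationDiff n l₀ l₁ l₂ α R r z 1‖) * M
      - (‖dilationDiff n l₀ l₁ l₂ α R r z (X ^ n)‖
          - ‖dilationDiff n l₀ l₁ l₂ α R r z 1‖) * m) := by
  by_cases hcirc : ∃ w : ℂ, ‖w‖ = 1 ∧ p.eval w = 0
  · obtain ⟨w₀, hw₀, hpw₀⟩ := hcirc
    have hm' : m = 0 := le_antisymm (by simpa [hpw₀] using hm w₀ hw₀) hm0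
    have hMpos : 0 < M := by
      by_contra! hM0
      have := Complex.norm_le_of_forall_mem_frontier_norm_le (f := fun v => p.eval v)
        (U := Metric.ball 0 1) Metric.isBounded_ball p.differentiable.diffContOnCl
        (C := 0) (fun v hv => by
          rw [frontier_ball 0 one_ne_zero, mem_sphere_zero_iff_norm] at hv
          exact (hM v hv).trans hM0) (z := 0) (subset_closure (by simp))
      exact hne 0 (by simp) (by simpa using this)
    have hball : ∀ w : ℂ, ‖w‖ ≤ 1 → ‖p.eval w‖ ≤ M := fun w hw => by
      have hMC : ‖(M : ℂ)‖ = M := by rw [Complex.norm_real, Real.norm_of_nonneg hMpos.le]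
      have := norm_eval_le_of_norm_eval_le_on_circle (f := p) (g := C (M : ℂ))
        (fun v hv => by rw [eval_C, hMC]; exact hM v hv)
        (fun v _ => by rw [eval_C]; exact_mod_cast hMpos.ne') hw
      rwa [eval_C, hMC] at this
    rw [hm']
    -- For `s < 1`, `p(sz)` is zero-free in the closed disc and still bounded by `M` on the circle.
    -- As `m = 0`, its minimum is not needed, and `s → 1` concludes.
    have hcont : Continuous fun s : ℝ => ‖dilationDiff n l₀ l₁ l₂ α R r z (dilate p s)‖ := by
      simp only [dilationDiff, eval_rahmanB_dilate]
      fun_prop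
    have hone : dilate p 1 = p := by simp [dilate]
    have hlim := (hcont.tendsto 1).mono_left (nhdsWithin_le_nhds (s := Set.Iio 1))
    rw [hone] at hlim
    refine le_of_tendsto hlim ?_
    filter_upwards [Ioo_mem_nhdsLT (zero_lt_one (α := ℝ))] with s hs
    have hns : ∀ w : ℂ, ‖(s : ℂ) * w‖ = s * ‖w‖ := fun w => by
      rw [norm_mul, Complex.norm_real, Real.norm_of_nonneg hs.1.le]
    refine norm_dilationDiff_le_of_ne_zero hn hB hα hr hR hz
      ?_ (fun w hw => ?_) le_rfl (fun w hw => ?_) (fun w _ => norm_nonneg _)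
    · exact natDegree_comp_le.trans ((Nat.mul_le_mul hp (natDegree_C_mul_le _ X)).trans
        (by simp))
    · rw [eval_dilate]
      exact hne _ (by rw [hns]; nlinarith [hs.1, hs.2])
    · rw [eval_dilate]
      exact hball _ (by rw [hns, hw]; linarith [hs.2])
  · push Not at hcirc
    exact norm_dilationDiff_le_of_ne_zero hn hB hα hr hR hz hp
      (fun w hw => hw.lt_or_eq.elim (hne w) (hcirc w)) hm0 hM hm

/-- This is the reduction to `k = 1`: the zero-free disc becomes the unit disc and `r ≥ k` becomes
`r/k ≥ 1`. -/
theorem dilationDiff_dilate {k : ℝ} (hk : k ≠ 0) (P : ℂ[X]) :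
    dilationDiff n l₀ l₁ l₂ α (R / k) (r / k) z (dilate P k)
      = dilationDiff n l₀ l₁ l₂ α R r z P := by
  have hkC : (k : ℂ) ≠ 0 := by exact_mod_cast hk
  have h : ∀ s : ℝ, (k : ℂ) * (((s / k : ℝ) : ℂ) * z) = s * z := fun s => by
    push_cast; field_simp
  simp only [dilationDiff, eval_rahmanB_dilate, h]

end dilationDiff

theorem lhsAt_le_rhsAt {n : ℕ} {l₀ l₁ l₂ : ℂ} (hB : RahmanAdmissible n l₀ l₁ l₂)
    {k : ℝ} (hk : 0 < k) {α : ℂ} (hα : ‖α‖ ≤ 1) {R r : ℝ} (hr : k ≤ r) (hR : r < R)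
    {P : ℂ[X]} (hP : P.natDegree ≤ n) (hne : ∀ z : ℂ, ‖z‖ < k → P.eval z ≠ 0)
    {z : ℂ} (hz : ‖z‖ = 1) :
    lhsAt n l₀ l₁ l₂ α R r P z ≤ rhsAt n l₀ l₁ l₂ α R r k P z := by
  have hmax := maxModulus_isGreatest P hk.le
  have hmin := minModulus_isLeast P hk.le
  have hM : ∀ w : ℂ, ‖w‖ = k → ‖P.eval w‖ ≤ maxModulus P k := fun w hw =>
    hmax.2 ⟨w, by simpa using hw, rfl⟩
  have hm : ∀ w : ℂ, ‖w‖ = k → minModulus P k ≤ ‖P.eval w‖ := fun w hw =>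
    hmin.2 ⟨w, by simpa using hw, rfl⟩
  have hm0 : 0 ≤ minModulus P k := by
    obtain ⟨w, -, hw⟩ := hmin.1
    rw [← hw]; exact norm_nonneg _
  rcases n.eq_zero_or_pos with rfl | hn
  -- For `n = 0` the operator is multiplication by `l₀` and both sides agree.
  · obtain ⟨c, rfl⟩ : ∃ c, P = C c := ⟨_, eq_C_of_natDegree_le_zero hP⟩
    obtain ⟨w, -, hw⟩ := hmax.1
    obtain ⟨v, -, hv⟩ := hmin.1
    simp only [eval_C] at hw hv
    rw [← norm_dilationDiff, dilationDiff_C, dilationDiff_one, rhsAt, ← hw, ← hv,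
      eval_rahmanB_X_pow]
    simp only [norm_mul, pow_zero, mul_one]
    simp
    apply le_of_eq; ring
  · have hns : ∀ w : ℂ, ‖(k : ℂ) * w‖ = k * ‖w‖ := fun w => by
      rw [norm_mul, Complex.norm_real, Real.norm_of_nonneg hk.le]
    have h := norm_dilationDiff_le (l₀ := l₀) (R := R / k) (r := r / k) (p := dilate P k)
      hn hB hα ((one_le_div hk).2 hr) (div_lt_div_of_pos_right hR hk) hz
      (natDegree_comp_le.trans ((Nat.mul_le_mul hP (natDegree_C_mul_le _ X)).trans (by simp)))
      (fun w hw => by rw [eval_dilate]; exact hne _ (by rw [hns]; nlinarith)) hm0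
      (fun w hw => by rw [eval_dilate]; exact hM _ (by rw [hns, hw, mul_one]))
      (fun w hw => by rw [eval_dilate]; exact hm _ (by rw [hns, hw, mul_one]))
    rw [dilationDiff_dilate hk.ne', norm_dilationDiff, dilationDiff_X_pow, dilationDiff_one,
      norm_mul, norm_mul] at h
    have hkC : (k : ℂ) ≠ 0 := by exact_mod_cast hk.ne'
    have e : ‖((R / k : ℝ) : ℂ) ^ n - α * ((r / k : ℝ) : ℂ) ^ n‖
        = ‖(R : ℂ) ^ n - α * (r : ℂ) ^ n‖ / k ^ n := by
      have : ((R / k : ℝ) : ℂ) ^ n - α * ((r / k : ℝ) : ℂ) ^ n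
          = ((R : ℂ) ^ n - α * (r : ℂ) ^ n) / (k : ℂ) ^ n := by
        push_cast; rw [div_pow, div_pow]; ring
      rw [this, norm_div, norm_pow, Complex.norm_real, Real.norm_of_nonneg hk.le]
    rw [e, ← mul_div_assoc, ← div_mul_eq_mul_div] at h
    exact h

/-! ### Sharpness -/

theorem exists_norm_eq_one_norm_add (n : ℕ) (hn : 0 < n) (x y : ℂ) :
    ∃ z : ℂ, ‖z‖ = 1 ∧ ‖x * z ^ n + y‖ = ‖x‖ + ‖y‖ := by
  obtain ⟨e, he, hes⟩ := exists_norm_eq_one_norm_sub y x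
  obtain ⟨z, hz⟩ := IsAlgClosed.exists_pow_nat_eq e hn
  refine ⟨z, (pow_eq_one_iff_of_nonneg (norm_nonneg z) hn.ne').1 (by rw [← norm_pow, hz, he]), ?_⟩
  have h := hes (-1)
  rw [abs_of_nonneg (by linarith [norm_nonneg x, norm_nonneg y])] at h
  rw [hz]
  convert h using 1
  · congr 1; push_cast; ring
  · ring

theorem maxModulus_C_mul_X_pow_add_C {n : ℕ} (hn : 0 < n) (a b : ℂ) {k : ℝ} (hk : 0 ≤ k) :
    maxModulus (C a * X ^ n + C b) k = ‖a‖ * k ^ n + ‖b‖ := by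
  refine (maxModulus_isGreatest _ hk).unique ⟨?_, ?_⟩
  · obtain ⟨z, hz, h⟩ := exists_norm_eq_one_norm_add n hn (a * (k : ℂ) ^ n) b
    refine ⟨k * z, by simp [hz, abs_of_nonneg hk], ?_⟩
    simp only [eval_add, eval_mul, eval_C, eval_pow, eval_X]
    rw [mul_pow, ← mul_assoc, h, norm_mul, norm_pow, Complex.norm_real, Real.norm_of_nonneg hk]
  · rintro _ ⟨z, hz, rfl⟩
    rw [mem_sphere_zero_iff_norm] at hz
    simp only [eval_add, eval_mul, eval_C, eval_pow, eval_X]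
    refine (norm_add_le _ _).trans_eq ?_
    rw [norm_mul, norm_pow, hz]

theorem minModulus_C_mul_X_pow_add_C {n : ℕ} (hn : 0 < n) (a b : ℂ) {k : ℝ} (hk : 0 ≤ k)
    (hab : ‖a‖ * k ^ n ≤ ‖b‖) :
    minModulus (C a * X ^ n + C b) k = ‖b‖ - ‖a‖ * k ^ n := by
  refine (minModulus_isLeast _ hk).unique ⟨?_, ?_⟩
  · obtain ⟨e, he, hes⟩ := exists_norm_eq_one_norm_sub b a
    obtain ⟨z, hz⟩ := IsAlgClosed.exists_pow_nat_eq (-e) hn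
    have hz1 : ‖z‖ = 1 := (pow_eq_one_iff_of_nonneg (norm_nonneg z) hn.ne').1
      (by rw [← norm_pow, hz, norm_neg, he])
    refine ⟨k * z, by simp [hz1, abs_of_nonneg hk], ?_⟩
    have h := hes (k ^ n)
    rw [abs_of_nonneg (by linarith)] at h
    simp only [eval_add, eval_mul, eval_C, eval_pow, eval_X]
    rw [mul_pow, hz, mul_comm ‖a‖, ← h]
    congr 1; push_cast; ring
  · rintro _ ⟨z, hz, rfl⟩
    rw [mem_sphere_zero_iff_norm] at hz
    simp only [eval_add, eval_mul, eval_C, eval_pow, eval_X]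
    have := norm_sub_norm_le b (-(a * z ^ n))
    rwa [sub_neg_eq_add, add_comm b, norm_neg, norm_mul, norm_pow, hz] at this

theorem exists_lhsAt_eq_rhsAt {n : ℕ} (hn : 0 < n) (l₀ l₁ l₂ α : ℂ) (R r : ℝ) {k : ℝ}
    (hk0 : 0 < k) (hk1 : k ≤ 1) {a b : ℂ} (hab : ‖a‖ = ‖b‖) :
    ∃ z : ℂ, ‖z‖ = 1 ∧ lhsAt n l₀ l₁ l₂ α R r (C a * X ^ n + C b) z
      = rhsAt n l₀ l₁ l₂ α R r k (C a * X ^ n + C b) z := by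
  obtain ⟨c, hc⟩ : ∃ c, c = l₀ + (n : ℂ) ^ 2 / 2 * l₁ + (n : ℂ) ^ 3 * (n - 1) / 8 * l₂ :=
    ⟨_, rfl⟩
  -- This `z` aligns the contributions of `a zⁿ` and `b` to `L`, so the left side is the sum of
  -- their moduli. With maximum `|b| + |a|kⁿ` and minimum `|b| - |a|kⁿ`, the right side collapses to
  -- the same sum.
  obtain ⟨z, hz, h⟩ := exists_norm_eq_one_norm_add n hn
    (a * c * ((R : ℂ) ^ n - α * (r : ℂ) ^ n)) (b * ((1 - α) * l₀))
  refine ⟨z, hz, ?_⟩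
  have hle : ‖a‖ * k ^ n ≤ ‖b‖ := by
    rw [← hab]
    exact mul_le_of_le_one_right (norm_nonneg a) (pow_le_one₀ hk0.le hk1)
  have hsplit : dilationDiff n l₀ l₁ l₂ α R r z (C a * X ^ n + C b)
      = a * c * ((R : ℂ) ^ n - α * (r : ℂ) ^ n) * z ^ n + b * ((1 - α) * l₀) := by
    have : (C a * X ^ n + C b : ℂ[X]) = C a * X ^ n - C (-b) := by rw [C_neg, sub_neg_eq_add]
    rw [this, dilationDiff_sub, dilationDiff_C_mul, dilationDiff_C, dilationDiff_one,
      dilationDiff_X_pow, eval_rahmanB_X_pow, hc]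
    ring
  rw [← norm_dilationDiff, hsplit, h, rhsAt, maxModulus_C_mul_X_pow_add_C hn a b hk0.le,
    minModulus_C_mul_X_pow_add_C hn a b hk0.le hle, eval_rahmanB_X_pow, ← hc]
  simp only [norm_mul, norm_pow, hz, one_pow, mul_one, ← hab]
  have : k ^ n ≠ 0 := (pow_pos hk0 n).ne'
  field_simp
  ring

/-- The inequality for all polynomials of degree at most `n` without zeros in `|z| < k`, and its
sharpness: every `a zⁿ + b` with `|a| = |b| ≠ 0` is such a polynomial (of exact degree `n ≥ 1`)
and gives equality at some point of the unit circle. -/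
theorem corollary2p9 (n : ℕ) (l₀ l₁ l₂ : ℂ) (hB : RahmanAdmissible n l₀ l₁ l₂)
    (k : ℝ) (hk0 : 0 < k) (hk1 : k ≤ 1) (α : ℂ) (hα : ‖α‖ ≤ 1)
    (R r : ℝ) (hr : k ≤ r) (hR : r < R) :
    (∀ P : ℂ[X], P.natDegree ≤ n → (∀ z : ℂ, ‖z‖ < k → P.eval z ≠ 0) →
      ∀ z : ℂ, ‖z‖ = 1 →
        lhsAt n l₀ l₁ l₂ α R r P z ≤ rhsAt n l₀ l₁ l₂ α R r k P z) ∧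
    (0 < n → ∀ a b : ℂ, ‖a‖ = ‖b‖ → b ≠ 0 →
      (C a * X ^ n + C b : ℂ[X]).natDegree = n ∧
      (∀ z : ℂ, ‖z‖ < k → (C a * X ^ n + C b : ℂ[X]).eval z ≠ 0) ∧
      ∃ z : ℂ, ‖z‖ = 1 ∧
        lhsAt n l₀ l₁ l₂ α R r (C a * X ^ n + C b) z
          = rhsAt n l₀ l₁ l₂ α R r k (C a * X ^ n + C b) z) := by
  refine ⟨fun P hP hne z hz => lhsAt_le_rhsAt hB hk0 hα hr hR hP hne hz,
    fun hn a b hab hb => ⟨?_, fun z hz h => ?_, exists_lhsAt_eq_rhsAt hn l₀ l₁ l₂ α R r hk0 hk1 hab⟩⟩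
  · have ha : a ≠ 0 := norm_ne_zero_iff.1 (hab ▸ norm_ne_zero_iff.2 hb)
    rw [natDegree_add_C, natDegree_C_mul_X_pow n a ha]
  · simp only [eval_add, eval_mul, eval_C, eval_pow, eval_X] at h
    have h1 : ‖a‖ * ‖z‖ ^ n = ‖b‖ := by
      rw [← norm_pow, ← norm_mul, eq_neg_of_add_eq_zero_left h, norm_neg]
    have h2 : ‖z‖ ^ n < 1 := pow_lt_one₀ (norm_nonneg z) (hz.trans_le hk1) hn.ne'
    have h3 : 0 < ‖b‖ := norm_pos_iff.2 hb
    rw [hab] at h1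
    nlinarith
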